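/- Let $\mathfrak H$ be a class of infinite regular cardinals with $\omega<\kappa=\inf\mathfrak H$ (in particular $\mathfrak H\neq\emptyset$). Then the following are equivalent: (a) $\kappa$ is weakly compact, i.e. $\kappa>\omega$ and $\kappa\to(\kappa)^2_2$: for every colouring of the two-element subsets of a set of size $\kappa$ with two colours there is a subset of size $\kappa$ all of whose two-element subsets have the same colour; (b) ($\mathbf{GP}(\mathfrak H)$) for every GO-space $X$: $X$ is $\mathfrak H$-compact if and only if $X$ has no gap and no pseudo-gap of type in $\mathfrak H$; (c) for every LOTS $X$: $X$ is $\mathfrak H$-compact if and only if $X$ has no gap and no pseudo-gap of type in $\mathfrak H$. Here a LOTS is a linearly ordered set with its order topology, and a GO-space is a linearly ordered set with a Hausdorff topology having a base of order-convex sets. A space is $\mathfrak H$-compact if for every $\mu\in\mathfrak H$ each open cover of cardinality $\le\mu$ has a subcover of cardinality $<\mu$. Consider pairs $(A,B)$ of open subsets of $X$ with $A\cup B=X$ and $a<b$ for all $a\in A$, $b\in B$. Such a pair is a gap if $A$ has no maximum and $B$ has no minimum ($A$ or $B$ may be empty); its types are the cofinality of $A$ and the coinitiality of $B$. It is a pseudo-gap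 if $A,B\neq\emptyset$ and either $A$ has no maximum and $B$ has a minimum, in which case its type is the cofinality of $A$, or $A$ has a maximum and $B$ has no minimum, in which case its type is the coinitiality of $B$. -/

import Mathlib

open Cardinal Set TopologicalSpace

universe u

/-- `[κ, μ]`-compactness: every open cover with at most `μ` members has a subcover with fewer
than `κ` members. -/
def IsIntervalCompact (κ μ : Cardinal.{u}) (X : Type u) [TopologicalSpace X] : Prop :=
  ∀ 𝒰 : Set (Set X), (∀ U ∈ 𝒰, IsOpen U) → ⋃₀ 𝒰 = Set.univ → #𝒰 ≤ μ →
    ∃ 𝒱 ⊆ 𝒰, ⋃₀ 𝒱 = Set.univ ∧ #𝒱 < κ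

/-- `H`-compactness for a class `H` of cardinals: `[μ, μ]`-compactness for every `μ ∈ H`. -/
def IsClassCompact (H : Set Cardinal.{u}) (X : Type u) [TopologicalSpace X] : Prop :=
  ∀ μ ∈ H, IsIntervalCompact μ μ X

/-- A generalized ordered space: a linearly ordered set with a Hausdorff topology having a base
of order-convex sets. -/
structure IsGOSpace (X : Type u) [LinearOrder X] [TopologicalSpace X] : Prop where
  t2 : T2Space X
  exists_convex_base : ∃ ℬ : Set (Set X), IsTopologicalBasis ℬ ∧ ∀ U ∈ ℬ, U.OrdConnected

/-- `(A, B)` is a cut of `X` into two open pieces, `A` below `B`; either piece may be empty. -/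
structure IsOpenCut {X : Type u} [LinearOrder X] [TopologicalSpace X] (A B : Set X) : Prop where
  isOpen_left : IsOpen A
  isOpen_right : IsOpen B
  union_eq : A ∪ B = Set.univ
  lt : ∀ a ∈ A, ∀ b ∈ B, a < b

/-- A gap (possibly an end gap, with `A` or `B` empty). -/
structure IsGap {X : Type u} [LinearOrder X] [TopologicalSpace X] (A B : Set X) : Prop
    extends IsOpenCut A B where
  no_max : ¬ ∃ a, IsGreatest A a
  no_min : ¬ ∃ b, IsLeast B b

/-- The cofinality of a subset of a linear order. -/
noncomputable def setCof {X : Type u} [LinearOrder X] (A : Set X) : Cardinal.{u} :=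
  Order.cof A

/-- The coinitiality of a subset of a linear order: the cofinality for the reversed order. -/
noncomputable def setCoinit {X : Type u} [LinearOrder X] (B : Set X) : Cardinal.{u} :=
  Order.cof (↥B)ᵒᵈ

/-- `X` has a gap one of whose (at most two) types is `μ`. -/
def HasGapOfType (X : Type u) [LinearOrder X] [TopologicalSpace X] (μ : Cardinal.{u}) : Prop :=
  ∃ A B : Set X, IsGap A B ∧ (setCof A = μ ∨ setCoinit B = μ)

/-- `X` has a pseudo-gap of type `μ`: an open cut into nonempty pieces such that either `A` has no
maximum, `B` has a minimum and `A` has cofinality `μ`, or `A` has a maximum, `B` has no minimum and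
`B` has coinitiality `μ`. -/
def HasPseudoGapOfType (X : Type u) [LinearOrder X] [TopologicalSpace X]
    (μ : Cardinal.{u}) : Prop :=
  ∃ A B : Set X, IsOpenCut A B ∧ A.Nonempty ∧ B.Nonempty ∧
    (((¬ ∃ a, IsGreatest A a) ∧ (∃ b, IsLeast B b) ∧ setCof A = μ) ∨
      ((∃ a, IsGreatest A a) ∧ (¬ ∃ b, IsLeast B b) ∧ setCoinit B = μ))

/-- `X` has neither gaps nor pseudo-gaps of type in `H`. -/
def HasNoGapsIn (H : Set Cardinal.{u}) (X : Type u) [LinearOrder X] [TopologicalSpace X] : Prop :=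
  ∀ μ ∈ H, ¬ HasGapOfType X μ ∧ ¬ HasPseudoGapOfType X μ

/-- Weakly compact cardinals: `κ` is uncountable and `κ → (κ)²₂`, that is, every colouring of the
unordered pairs from a set of size `κ` in two colours has a homogeneous set of size `κ` (the values
of the colouring on the diagonal of `Sym2 S` play no role). -/
def IsWeaklyCompact (κ : Cardinal.{u}) : Prop :=
  ℵ₀ < κ ∧ ∀ S : Type u, #S = κ → ∀ c : Sym2 S → Bool,
    ∃ T : Set S, #T = κ ∧ ∃ i : Bool, ∀ x ∈ T, ∀ y ∈ T, x ≠ y → c s(x, y) = i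

/-- The statement `GP(H)`. -/
def GP (H : Set Cardinal.{u}) : Prop :=
  ∀ (X : Type u) [LinearOrder X] [TopologicalSpace X], IsGOSpace X →
    (IsClassCompact H X ↔ HasNoGapsIn H X)

/-- The same statement for linearly ordered topological spaces (LOTS) only. -/
def LOTSGP (H : Set Cardinal.{u}) : Prop :=
  ∀ (X : Type u) [LinearOrder X] [TopologicalSpace X] [OrderTopology X],
    (IsClassCompact H X ↔ HasNoGapsIn H X)

/-! Gaps and pseudo-gaps of regular type `μ` are exactly open cuts having a side of cofinality (or
coinitiality) `μ` with no extremum at the cut (`hasGap_or_hasPseudoGap_iff`). Such a cut defeats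
`[μ, μ]`-compactness by a cover with rays.

Suppose `κ` is weakly compact and `[μ, μ]`-compactness fails. Then some `μ`-sequence `y` has fewer
than `μ` terms near each point. "Fewer than `μ` terms in between" is an equivalence relation with
convex open classes, so every union of classes is clopen. A class with `μ` terms yields a cut of
type `μ`; otherwise there are at least `κ` classes, and weak compactness extracts a monotone
`κ`-sequence of them, hence a cut of type `κ`.

If `κ` is not weakly compact, order the colour sequences of a bad colouring lexicographically. A
strictly monotone `κ`-sequence would stabilise at each coordinate and produce a homogeneous set.
Replacing points by copies of `ℤ` gives a discrete LOTS of size `κ`: it is not `[κ, κ]`-compact, yet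
has no cut of type in `H`. -/

/-! ### Homogeneous sets from lexicographically monotone sequences -/

theorem exists_forall_lt_of_mk_lt {κ : Cardinal.{u}} (hκ : κ.IsRegular) {S : Set κ.ord.ToType}
    (hS : #S < κ) : ∃ x, ∀ y ∈ S, y < x :=
  not_isCofinal_iff.1 fun hc => (Order.cof_le hc).not_gt (by
    rwa [Ordinal.cof_toType, hκ.cof_ord])

theorem mk_Iio_ordToType_lt {κ : Cardinal.{u}} (i : κ.ord.ToType) : #(Iio i) < κ := by
  simpa using mk_Iio_lt i

theorem mk_union_lt {κ : Cardinal.{u}} (hκ : ℵ₀ ≤ κ) {α : Type u} {S T : Set α}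
    (hS : #S < κ) (hT : #T < κ) : #(S ∪ T : Set α) < κ :=
  (mk_union_le S T).trans_lt (add_lt_of_lt hκ hS hT)

theorem mk_Iic_ordToType_lt {κ : Cardinal.{u}} (hκ : ℵ₀ ≤ κ) (i : κ.ord.ToType) :
    #(Iic i) < κ := by
  rw [← Iio_union_right]
  exact mk_union_lt hκ (mk_Iio_ordToType_lt i) (by
    rw [mk_singleton]; exact one_lt_aleph0.trans_le hκ)

theorem mk_preimage_lt_of_fibers_lt {κ : Cardinal.{u}} (hκ : κ.IsRegular) {α β : Type u}
    (a : α → β) (ha : ∀ b, #(a ⁻¹' {b}) < κ) {S : Set β} (hS : #S < κ) : #(a ⁻¹' S) < κ := by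
  have : a ⁻¹' S = ⋃ b ∈ S, a ⁻¹' {b} := by ext; simp
  rw [this, card_biUnion_lt_iff_forall_of_isRegular hκ hS]
  exact fun b _ => ha b

/-- A lexicographically monotone sequence of regular length `κ`, with coordinates indexed by `κ` and
values in a finite linear order, is eventually constant at every coordinate. -/
theorem eventually_const_coordinates {κ : Cardinal.{u}} (hκ : κ.IsRegular) {V : Type*}
    [LinearOrder V] [Finite V] (h : κ.ord.ToType → κ.ord.ToType → V)
    (hh : ∀ s t, s ≤ t → ∀ γ, (∀ δ < γ, h s δ = h t δ) → h s γ ≤ h t γ) (γ : κ.ord.ToType) :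
    ∃ s, ∀ t, s ≤ t → h t γ = h s γ := by
  induction γ using WellFoundedLT.induction with
  | ind γ ih =>
    have : Nonempty κ.ord.ToType := ⟨γ⟩
    choose! σ hσ using ih
    obtain ⟨x, hx⟩ := exists_forall_lt_of_mk_lt hκ (S := σ '' Iio γ)
      (mk_image_le.trans_lt (mk_Iio_ordToType_lt γ))
    have hx' : ∀ δ < γ, ∀ t, x ≤ t → h t δ = h (σ δ) δ := fun δ hδ t ht =>
      hσ δ hδ t ((hx _ (mem_image_of_mem σ hδ)).le.trans ht)
    -- Beyond `x` all earlier coordinates are frozen, so coordinate `γ` is monotone there and keeps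
    -- its largest value once attained.
    obtain ⟨_, ⟨s, hs, rfl⟩, hmax⟩ := (wellFounded_gt (α := V)).has_min
      ((fun s => h s γ) '' Ici x) ⟨_, x, self_mem_Ici, rfl⟩
    refine ⟨s, fun t ht => le_antisymm ?_ ?_⟩
    · exact not_lt.1 (hmax _ ⟨t, le_trans hs ht, rfl⟩)
    · exact hh s t ht γ fun δ hδ => (hx' δ hδ s hs).trans (hx' δ hδ t (le_trans hs ht)).symm

/-- The sequence of colours of the pairs `{γ, α}` with `γ < α`, continued by `⊥`, as an element of
a lexicographically ordered power. -/
noncomputable def colourSeq {I : Type u} [LinearOrder I] (c : Sym2 I → Bool) (α : I) :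
    Lex (I → WithBot Bool) :=
  toLex fun γ => if γ < α then (c s(γ, α) : WithBot Bool) else ⊥

theorem colourSeq_injective {I : Type u} [LinearOrder I] (c : Sym2 I → Bool) :
    Function.Injective (colourSeq c) := by
  have key : ∀ α β : I, α < β → colourSeq c α ≠ colourSeq c β := by
    intro α β hαβ h
    have := congrFun h α
    simp [colourSeq, hαβ] at this
  intro α β h
  rcases lt_trichotomy α β with h' | h' | h'
  · exact (key _ _ h' h).elim
  · exact h'
  · exact (key _ _ h' h.symm).elim

/-- Each `γ` has a limit colour `g γ`, the colour of `{γ, a t}` for all large `t`. One limit colour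
`i` occurs for `κ` many indices, and a maximal `i`-homogeneous set of such points has size `κ`: a
smaller one could be extended by a late `a s`. -/
theorem exists_homogeneous_of_eventually_const {κ : Cardinal.{u}} (hκ : κ.IsRegular)
    (c : Sym2 κ.ord.ToType → Bool) (a : κ.ord.ToType → κ.ord.ToType)
    (ha : ∀ γ, #(a ⁻¹' {γ}) < κ)
    (hc : ∀ γ, ∃ s, ∀ t, s ≤ t → colourSeq c (a t) γ = colourSeq c (a s) γ) :
    ∃ T : Set κ.ord.ToType, #T = κ ∧ ∃ i : Bool, ∀ x ∈ T, ∀ y ∈ T, x ≠ y → c s(x, y) = i := by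
  have hlim : ∀ γ, ∃ τ, ∃ i : Bool, ∀ t, τ ≤ t → γ < a t ∧ c s(γ, a t) = i := by
    intro γ
    obtain ⟨s, hs⟩ := hc γ
    obtain ⟨x, hx⟩ := exists_forall_lt_of_mk_lt hκ
      (mk_preimage_lt_of_fibers_lt hκ a ha (mk_Iic_ordToType_lt hκ.aleph0_le γ))
    have hx' : ∀ t, x ≤ t → γ < a t := fun t ht => by
      by_contra hlt
      exact (hx t (not_lt.1 hlt)).not_ge ht
    refine ⟨max s x, c s(γ, a (max s x)), fun t ht => ⟨hx' t (le_trans (le_max_right _ _) ht), ?_⟩⟩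
    have := (hs t (le_trans (le_max_left _ _) ht)).trans (hs _ (le_max_left s x)).symm
    simpa [colourSeq, hx' t (le_trans (le_max_right _ _) ht), hx' _ (le_max_right s x)] using this
  choose τ g hg using hlim
  obtain ⟨i, hi⟩ : ∃ i : Bool, κ ≤ #{s | g (a s) = i} := by
    by_contra! hlt
    have := mk_union_lt hκ.aleph0_le (hlt true) (hlt false)
    have huniv : {s | g (a s) = true} ∪ {s | g (a s) = false} = Set.univ := by
      ext s; cases hgs : g (a s) <;> simp [hgs]
    rw [huniv, mk_univ, mk_ord_toType] at this
    exact this.false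
  obtain ⟨P, hP⟩ := zorn_subset
    {P : Set κ.ord.ToType | P ⊆ a '' {s | g (a s) = i} ∧
      ∀ x ∈ P, ∀ y ∈ P, x ≠ y → c s(x, y) = i} (by
    intro C hC hchain
    refine ⟨⋃₀ C, ⟨sUnion_subset fun P hP => (hC hP).1, ?_⟩, fun P => subset_sUnion_of_mem⟩
    rintro x ⟨P, hP, hx⟩ y ⟨Q, hQ, hy⟩ hxy
    rcases hchain.total hP hQ with h | h
    · exact (hC hQ).2 x (h hx) y hy hxy
    · exact (hC hP).2 x hx y (h hy) hxy)
  refine ⟨P, ?_, i, hP.prop.2⟩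
  by_contra hne
  have hPlt : #P < κ := lt_of_le_of_ne ((mk_set_le P).trans_eq (mk_ord_toType κ)) hne
  obtain ⟨x, hx⟩ := exists_forall_lt_of_mk_lt hκ (S := τ '' P) (mk_image_le.trans_lt hPlt)
  obtain ⟨s, hs, hxs⟩ : ∃ s, g (a s) = i ∧ x ≤ s := by
    by_contra! hlt
    exact ((mk_le_mk_of_subset (fun s hs => hlt s hs)).trans_lt
      (mk_Iio_ordToType_lt x)).not_ge hi
  have hPs : ∀ γ ∈ P, γ < a s ∧ c s(γ, a s) = i := by
    intro γ hγ
    obtain ⟨s', hs', rfl⟩ := hP.prop.1 hγ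
    have := hg _ s ((hx _ (mem_image_of_mem τ hγ)).le.trans hxs)
    exact ⟨this.1, this.2.trans hs'⟩
  have hmem : a s ∈ P := by
    refine hP.le_of_ge (y := insert (a s) P) ⟨insert_subset ⟨s, hs, rfl⟩ hP.prop.1, ?_⟩
      (subset_insert _ _) (mem_insert _ _)
    rintro y (rfl | hy) z (rfl | hz) hyz
    · exact (hyz rfl).elim
    · rw [Sym2.eq_swap]; exact (hPs z hz).2
    · exact (hPs y hy).2
    · exact hP.prop.2 y hy z hz hyz
  exact (hPs _ hmem).1.false

theorem exists_homogeneous_of_monotone {κ : Cardinal.{u}} (hκ : κ.IsRegular)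
    (c : Sym2 κ.ord.ToType → Bool) (a : κ.ord.ToType → κ.ord.ToType)
    (ha : ∀ γ, #(a ⁻¹' {γ}) < κ)
    (hmono : Monotone (colourSeq c ∘ a) ∨ Antitone (colourSeq c ∘ a)) :
    ∃ T : Set κ.ord.ToType, #T = κ ∧ ∃ i : Bool, ∀ x ∈ T, ∀ y ∈ T, x ≠ y → c s(x, y) = i := by
  refine exists_homogeneous_of_eventually_const hκ c a ha ?_
  have : Finite (WithBot Bool) := inferInstanceAs (Finite (Option Bool))
  rcases hmono with h | h
  · exact eventually_const_coordinates hκ (fun s γ => ofLex (colourSeq c (a s)) γ)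
      fun s t hst γ hγ => Pi.apply_le_of_toLex (h hst) hγ
  -- Reversing the order of the values turns the antitone case into the monotone one.
  · exact eventually_const_coordinates hκ (V := (WithBot Bool)ᵒᵈ)
      (fun s γ => OrderDual.toDual (ofLex (colourSeq c (a s)) γ))
      fun s t hst γ hγ => Pi.apply_le_of_toLex (h hst) fun δ hδ => (hγ δ hδ).symm

theorem exists_homogeneous_of_equiv {κ : Cardinal.{u}} {S S' : Type u} (e : S ≃ S')
    (c : Sym2 S' → Bool) (h : ∃ T : Set S, #T = κ ∧ ∃ i : Bool, ∀ x ∈ T, ∀ y ∈ T, x ≠ y →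
      c (Sym2.map e s(x, y)) = i) :
    ∃ T : Set S', #T = κ ∧ ∃ i : Bool, ∀ x ∈ T, ∀ y ∈ T, x ≠ y → c s(x, y) = i := by
  obtain ⟨T, hT, i, hi⟩ := h
  refine ⟨e '' T, (mk_image_eq e.injective).trans hT, i, ?_⟩
  rintro _ ⟨x, hx, rfl⟩ _ ⟨y, hy, rfl⟩ hxy
  exact hi x hx y hy fun h => hxy (congrArg e h)

/-- If `κ` is not weakly compact, some discrete linear order of size `κ` has no strictly monotone
sequence of length `κ`. -/
theorem exists_linearOrder_of_not_isWeaklyCompact {κ : Cardinal.{u}} (hκ : κ.IsRegular)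
    (hω : ℵ₀ < κ) (hwc : ¬ IsWeaklyCompact κ) :
    ∃ (X : Type u) (_ : LinearOrder X), #X = κ ∧ (∀ x : X, ∃ a b : X, Ioo a b = {x}) ∧
      ∀ f : κ.ord.ToType → X, ¬ StrictMono f ∧ ¬ StrictAnti f := by
  obtain ⟨c, hc⟩ : ∃ c : Sym2 κ.ord.ToType → Bool, ¬ ∃ T : Set κ.ord.ToType, #T = κ ∧
      ∃ i : Bool, ∀ x ∈ T, ∀ y ∈ T, x ≠ y → c s(x, y) = i := by
    by_contra! h
    refine hwc ⟨hω, fun S hS c => ?_⟩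
    obtain ⟨e⟩ := Cardinal.eq.1 ((mk_ord_toType κ).trans hS.symm)
    exact exists_homogeneous_of_equiv e c (h fun p => c (p.map e))
  refine ⟨range (colourSeq c) ×ₗ ℤ, inferInstance, ?_, ?_, ?_⟩
  · have : #(range (colourSeq c) × ℤ) = κ := by
      rw [mk_prod, mk_range_eq _ (colourSeq_injective c)]
      simpa using mul_eq_left hω.le hω.le aleph0_ne_zero
    exact this
  · intro x
    refine ⟨toLex ((ofLex x).1, (ofLex x).2 - 1), toLex ((ofLex x).1, (ofLex x).2 + 1), ?_⟩
    ext y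
    simp only [mem_Ioo, mem_singleton_iff, Prod.Lex.lt_iff, ofLex_toLex]
    constructor
    · rintro ⟨h1 | ⟨h1, h1'⟩, h2 | ⟨h2, h2'⟩⟩
      · exact (h1.trans h2).false.elim
      · exact (h1.ne h2.symm).elim
      · exact (h2.ne h1.symm).elim
      · exact ofLex_inj.1 (Prod.ext h2 (by omega))
    · rintro rfl
      exact ⟨.inr ⟨rfl, by omega⟩, .inr ⟨rfl, by omega⟩⟩
  · intro f
    have ha : ∀ s, ∃ α, colourSeq c α = ((ofLex (f s)).1 : Lex (κ.ord.ToType → WithBot Bool)) :=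
      fun s => (ofLex (f s)).1.2
    choose a ha using ha
    -- Terms over one colour sequence differ in their integers, so fibres are countable; here `ℵ₀ <
    -- κ` matters.
    have hfib : Function.Injective f → ∀ γ, #(a ⁻¹' {γ}) < κ := by
      intro hf γ
      refine lt_of_le_of_lt ?_ hω
      have hinj : Function.Injective fun s : a ⁻¹' {γ} => (ofLex (f s)).2 := by
        intro s t hst
        have h1 : (ofLex (f s)).1 = (ofLex (f t)).1 := by
          apply Subtype.ext
          rw [← ha, ← ha, s.2, t.2]
        exact Subtype.ext (hf (ofLex_inj.1 (Prod.ext h1 hst)))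
      exact mk_le_aleph0_iff.2 hinj.countable
    refine ⟨fun hf => hc ?_, fun hf => hc ?_⟩
    · refine exists_homogeneous_of_monotone hκ c a (hfib hf.injective) (.inl fun s t hst => ?_)
      simp only [Function.comp, ha]
      exact Prod.Lex.monotone_fst_ofLex (hf.monotone hst)
    · refine exists_homogeneous_of_monotone hκ c a (hfib hf.injective) (.inr fun s t hst => ?_)
      simp only [Function.comp, ha]
      exact Prod.Lex.monotone_fst_ofLex (hf.antitone hst)

theorem exists_strictMono_of_cof_eq {κ : Cardinal.{u}} {A : Type u} [LinearOrder A]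
    (hA : Order.cof A = κ) : ∃ f : κ.ord.ToType → A, StrictMono f := by
  have hb : ∀ S : Set A, #S < κ → ∃ x, ∀ y ∈ S, y < x := fun S hS =>
    not_isCofinal_iff.1 fun hc => (Order.cof_le hc).not_gt (hA ▸ hS)
  by_cases hne : Nonempty A
  · choose! g hg using hb
    let f : κ.ord.ToType → A := WellFoundedLT.fix fun i ih => g (range fun j : Iio i => ih j j.2)
    have hf : ∀ i, f i = g (range fun j : Iio i => f j) := fun i => WellFoundedLT.fix_eq _ i
    refine ⟨f, fun i j hij => ?_⟩
    rw [hf j]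
    exact hg _ (mk_range_le.trans_lt (mk_Iio_ordToType_lt j)) _ ⟨⟨i, hij⟩, rfl⟩
  · rw [not_nonempty_iff] at hne
    have : κ = 0 := by rw [← hA, Order.cof_eq_zero]
    subst this
    have : IsEmpty (ord (0 : Cardinal.{u})).ToType := by
      rw [← mk_eq_zero_iff, mk_ord_toType]
    exact ⟨isEmptyElim, fun i => isEmptyElim i⟩

theorem mk_setOf_mem_mono {X J : Type u} (y : J → X) {U V : Set X} (h : U ⊆ V) :
    #{j | y j ∈ U} ≤ #{j | y j ∈ V} :=
  mk_le_mk_of_subset fun _ hj => h hj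

/-! ### Few members of a family between two points -/

section LinearOrder

variable {X : Type u} [LinearOrder X]

theorem setCof_dual (B : Set X) :
    setCof (X := Xᵒᵈ) (OrderDual.ofDual ⁻¹' B) = setCoinit B :=
  OrderIso.cof_congr
    { toFun := fun b => OrderDual.toDual ⟨OrderDual.ofDual b.1, b.2⟩
      invFun := fun b => ⟨OrderDual.toDual (OrderDual.ofDual b).1, (OrderDual.ofDual b).2⟩
      left_inv := fun _ => rfl
      right_inv := fun _ => rfl
      map_rel_iff' := Iff.rfl }

theorem nonempty_of_setCof_ne_zero {A : Set X} (h : setCof A ≠ 0) : A.Nonempty :=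
  nonempty_coe_sort.1 (Order.cof_ne_zero_iff.1 h)

theorem nonempty_of_setCoinit_ne_zero {A : Set X} (h : setCoinit A ≠ 0) : A.Nonempty :=
  nonempty_of_setCof_ne_zero (X := Xᵒᵈ) (A := OrderDual.ofDual ⁻¹' A) (by rwa [setCof_dual])

/-- Fewer than `μ` members of the family `y` lie between `a` and `b`. -/
def FewBetween {J : Type u} (μ : Cardinal.{u}) (y : J → X) (a b : X) : Prop :=
  #{j | y j ∈ uIcc a b} < μ

variable {J : Type u} {μ : Cardinal.{u}} {y : J → X} {a b c : X}

theorem FewBetween.symm (h : FewBetween μ y a b) : FewBetween μ y b a := by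
  rwa [FewBetween, uIcc_comm]

theorem FewBetween.trans (hμ : ℵ₀ ≤ μ) (h : FewBetween μ y a b) (h' : FewBetween μ y b c) :
    FewBetween μ y a c :=
  (mk_setOf_mem_mono y uIcc_subset_uIcc_union_uIcc).trans_lt (mk_union_lt hμ h h')

theorem FewBetween.mono {a' b' : X} (h : FewBetween μ y a b) (ha : a' ∈ uIcc a b)
    (hb : b' ∈ uIcc a b) : FewBetween μ y a' b' :=
  (mk_setOf_mem_mono y (uIcc_subset_uIcc ha hb)).trans_lt h

theorem fewBetween_dual_iff :
    FewBetween (X := Xᵒᵈ) μ (OrderDual.toDual ∘ y) (OrderDual.toDual a) (OrderDual.toDual b) ↔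
      FewBetween μ y a b := by
  simp [FewBetween, uIcc_toDual]

end LinearOrder

/-! ### GO-spaces and open cuts -/

section GOSpace

variable {X : Type u} [LinearOrder X] [TopologicalSpace X]

theorem IsGOSpace.exists_ordConnected (hX : IsGOSpace X) {x : X} {U : Set X} (hU : IsOpen U)
    (hx : x ∈ U) : ∃ V, IsOpen V ∧ V.OrdConnected ∧ x ∈ V ∧ V ⊆ U := by
  obtain ⟨ℬ, hℬ, hconv⟩ := hX.exists_convex_base
  obtain ⟨V, hV, hxV, hVU⟩ := hℬ.exists_subset_of_mem_open hx hU
  exact ⟨V, hℬ.isOpen hV, hconv V hV, hxV, hVU⟩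

theorem IsGOSpace.isOpen_Iio (hX : IsGOSpace X) (a : X) : IsOpen (Iio a) := by
  have := hX.t2
  rw [isOpen_iff_forall_mem_open]
  intro x hx
  obtain ⟨V, hV, hconv, hxV, hVU⟩ := hX.exists_ordConnected (isOpen_compl_singleton (x := a))
    (show x ∈ ({a}ᶜ : Set X) from ne_of_lt hx)
  refine ⟨V, fun z hz => ?_, hV, hxV⟩
  by_contra hza
  exact hVU (hconv.out hxV hz ⟨le_of_lt hx, not_lt.1 hza⟩) rfl

theorem IsGOSpace.dual (hX : IsGOSpace X) : IsGOSpace Xᵒᵈ where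
  t2 := hX.t2
  exists_convex_base := by
    obtain ⟨ℬ, hℬ, hconv⟩ := hX.exists_convex_base
    exact ⟨ℬ, hℬ, fun U hU => (hconv U hU).dual⟩

theorem IsGOSpace.of_orderTopology [OrderTopology X] : IsGOSpace X where
  t2 := inferInstance
  exists_convex_base := by
    refine ⟨_, isTopologicalBasis_of_subbasis (OrderTopology.topology_eq_generate_intervals), ?_⟩
    rintro _ ⟨F, ⟨-, hF⟩, rfl⟩
    refine ordConnected_sInter fun s hs => ?_
    obtain ⟨a, rfl | rfl⟩ := hF hs
    · exact ordConnected_Ioi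
    · exact ordConnected_Iio

variable (X) in
/-- `X` has an open cut whose lower piece has no maximum and has cofinality `μ`. -/
def HasLeftCutOfType (μ : Cardinal.{u}) : Prop :=
  ∃ A B : Set X, IsOpenCut A B ∧ (¬ ∃ a, IsGreatest A a) ∧ setCof A = μ

theorem IsOpenCut.dual {A B : Set X} (h : IsOpenCut A B) :
    IsOpenCut (X := Xᵒᵈ) (OrderDual.ofDual ⁻¹' B) (OrderDual.ofDual ⁻¹' A) where
  isOpen_left := h.isOpen_right
  isOpen_right := h.isOpen_left
  union_eq := (union_comm _ _).trans h.union_eq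
  lt := fun b hb a ha => h.lt a ha b hb

theorem hasLeftCutOfType_dual_iff {μ : Cardinal.{u}} :
    HasLeftCutOfType Xᵒᵈ μ ↔
      ∃ A B : Set X, IsOpenCut A B ∧ (¬ ∃ b, IsLeast B b) ∧ setCoinit B = μ := by
  constructor
  · rintro ⟨B, A, h, hB, hμ⟩
    exact ⟨OrderDual.toDual ⁻¹' A, OrderDual.toDual ⁻¹' B, h.dual, hB,
      (setCof_dual (OrderDual.toDual ⁻¹' B)).symm.trans hμ⟩
  · rintro ⟨A, B, h, hB, hμ⟩
    exact ⟨OrderDual.ofDual ⁻¹' B, OrderDual.ofDual ⁻¹' A, h.dual, hB, (setCof_dual B).trans hμ⟩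

/-- The two notions differ only in whether the opposite piece has an extremum at the cut; `μ ≠ 0`
supplies the nonempty piece that a pseudo-gap still needs. -/
theorem hasGap_or_hasPseudoGap_iff {μ : Cardinal.{u}} (hμ : μ ≠ 0) :
    HasGapOfType X μ ∨ HasPseudoGapOfType X μ ↔
      HasLeftCutOfType X μ ∨ HasLeftCutOfType Xᵒᵈ μ := by
  rw [hasLeftCutOfType_dual_iff]
  constructor
  · rintro (⟨A, B, h, hA | hB⟩ | ⟨A, B, h, -, -, ⟨hA, -, hc⟩ | ⟨-, hB, hc⟩⟩)
    · exact .inl ⟨A, B, h.toIsOpenCut, h.no_max, hA⟩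
    · exact .inr ⟨A, B, h.toIsOpenCut, h.no_min, hB⟩
    · exact .inl ⟨A, B, h, hA, hc⟩
    · exact .inr ⟨A, B, h, hB, hc⟩
  · rintro (⟨A, B, h, hA, hc⟩ | ⟨A, B, h, hB, hc⟩)
    · by_cases hB : ∃ b, IsLeast B b
      · exact .inr ⟨A, B, h, nonempty_of_setCof_ne_zero (hc.trans_ne hμ), hB.imp fun _ hb => hb.1,
          .inl ⟨hA, hB, hc⟩⟩
      · exact .inl ⟨A, B, { h with no_max := hA, no_min := hB }, .inl hc⟩
    · by_cases hA : ∃ a, IsGreatest A a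
      · exact .inr ⟨A, B, h, hA.imp fun _ ha => ha.1,
          nonempty_of_setCoinit_ne_zero (hc.trans_ne hμ), .inr ⟨hA, hB, hc⟩⟩
      · exact .inl ⟨A, B, { h with no_max := hA, no_min := hB }, .inr hc⟩

theorem hasNoGapsIn_iff {H : Set Cardinal.{u}} (hH : ∀ μ ∈ H, μ.IsRegular) :
    HasNoGapsIn H X ↔ ∀ μ ∈ H, ¬ HasLeftCutOfType X μ ∧ ¬ HasLeftCutOfType Xᵒᵈ μ :=
  forall₂_congr fun μ hμ => by
    rw [← not_or, ← not_or, hasGap_or_hasPseudoGap_iff (hH μ hμ).ne_zero]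

theorem IsIntervalCompact.not_hasLeftCutOfType (hX : IsGOSpace X) {μ : Cardinal.{u}}
    (hμ : ℵ₀ ≤ μ) (hc : IsIntervalCompact μ μ X) : ¬ HasLeftCutOfType X μ := by
  rintro ⟨A, B, h, hmax, hcof⟩
  obtain ⟨S, hS, hSμ⟩ := Order.exists_cof_eq A
  obtain ⟨𝒱, h𝒱, hcov, hlt⟩ := hc (insert B ((fun s : A => Iio (s : X)) '' S))
    (by
      rintro _ (rfl | ⟨s, -, rfl⟩)
      · exact h.isOpen_right
      · exact hX.isOpen_Iio _)
    (by
      refine eq_univ_of_forall fun x => ?_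
      rcases h.union_eq.symm.subset (mem_univ x) with hx | hx
      · obtain ⟨a, ha, hxa⟩ : ∃ a ∈ A, x < a := by
          by_contra! hle
          exact hmax ⟨x, hx, hle⟩
        obtain ⟨s, hs, has⟩ := hS ⟨a, ha⟩
        exact ⟨_, .inr ⟨s, hs, rfl⟩, hxa.trans_le has⟩
      · exact ⟨B, .inl rfl, hx⟩)
    (by
      refine (mk_insert_le).trans ((add_le_add_left mk_image_le 1).trans ?_)
      rw [hSμ, show Order.cof A = μ from hcof]
      exact (add_one_eq hμ).le)
  -- Distinct `s` give distinct rays, so the rays in a small subcover have too few endpoints to be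
  -- cofinal in `A`.
  have hS' : ¬ IsCofinal {s : A | Iio (s : X) ∈ 𝒱} := by
    intro hcofinal
    have hle : #{s : A | Iio (s : X) ∈ 𝒱} ≤ #𝒱 :=
      mk_le_of_injective (f := fun s => (⟨Iio (s.1 : X), s.2⟩ : 𝒱)) fun s t hst =>
        Subtype.ext (Subtype.ext (Iio_injective (congrArg Subtype.val hst)))
    exact ((Order.cof_le hcofinal).trans hle).not_gt (hlt.trans_eq hcof.symm)
  obtain ⟨a, ha⟩ := not_isCofinal_iff.1 hS'
  obtain ⟨V, hV, haV⟩ := hcov.symm.subset (mem_univ (a : X))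
  rcases h𝒱 hV with rfl | ⟨s, hs, rfl⟩
  · exact (h.lt _ a.2 _ haV).false
  · exact (ha s hV).not_gt haV

/-- The family is cofinal in its downward closure, and fewer than `μ` points there dominate fewer
than `μ` indices by regularity, so the cofinality is exactly `μ`. -/
theorem hasLeftCutOfType_of_isClopen {μ : Cardinal.{u}} (hμ : μ.IsRegular) {J : Type u}
    (hJ : #J = μ) (y : J → X) (hA : IsOpen {a | ∃ t, a ≤ y t}) (hB : IsOpen {a | ∃ t, a ≤ y t}ᶜ)
    (hlt : ∀ t, #{j | y j ≤ y t} < μ) : HasLeftCutOfType X μ := by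
  refine ⟨_, _, ⟨hA, hB, union_compl_self _, ?_⟩, ?_, ?_⟩
  · rintro a ⟨t, ht⟩ b hb
    by_contra hba
    exact hb ⟨t, (not_lt.1 hba).trans ht⟩
  · rintro ⟨a, ⟨t, ht⟩, ha⟩
    refine (hlt t).not_ge (hJ ▸ ?_)
    rw [show {j | y j ≤ y t} = Set.univ from
      eq_univ_of_forall fun j => (ha ⟨j, le_rfl⟩).trans ht, mk_univ]
  · refine le_antisymm ?_ (Order.le_cof_iff.2 fun S hS => ?_)
    · refine (Order.cof_le (s := range fun t => (⟨y t, t, le_rfl⟩ : {a | ∃ t, a ≤ y t})) ?_).trans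
        (mk_range_le.trans_eq hJ)
      rintro ⟨a, t, ht⟩
      exact ⟨_, ⟨t, rfl⟩, ht⟩
    · by_contra! hSμ
      have hun : (⋃ a : S, {j | y j ≤ a.1.1}) = Set.univ := by
        refine eq_univ_of_forall fun j => ?_
        obtain ⟨a, ha, hja⟩ := hS ⟨y j, j, le_rfl⟩
        exact mem_iUnion.2 ⟨⟨a, ha⟩, hja⟩
      have := (card_iUnion_lt_iff_forall_of_isRegular (t := fun a : S => {j | y j ≤ a.1.1})
        hμ hSμ).2 (by
        rintro ⟨⟨a, t, hat⟩, ha⟩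
        exact (mk_le_mk_of_subset fun j hj => le_trans hj hat).trans_lt (hlt t))
      rw [hun, mk_univ, hJ] at this
      exact this.false

/-! ### Locally small families and the cuts they determine -/

/-- Every point has an order-convex open neighbourhood containing fewer than `μ` members of the
family `y`. -/
def LocallyFew {J : Type u} (μ : Cardinal.{u}) (y : J → X) : Prop :=
  ∀ x, ∃ U : Set X, IsOpen U ∧ U.OrdConnected ∧ x ∈ U ∧ #{j | y j ∈ U} < μ

section

variable {J : Type u} {μ : Cardinal.{u}} {y : J → X}

theorem LocallyFew.dual (h : LocallyFew μ y) :
    LocallyFew (X := Xᵒᵈ) μ (OrderDual.toDual ∘ y) := fun x =>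
  (h (OrderDual.ofDual x)).imp fun _ hU => ⟨hU.1, hU.2.1.dual, hU.2.2⟩

theorem LocallyFew.fewBetween_self (h : LocallyFew μ y) (x : X) : FewBetween μ y x x := by
  obtain ⟨U, -, hconv, hxU, hlt⟩ := h x
  exact (mk_setOf_mem_mono y (hconv.uIcc_subset hxU hxU)).trans_lt hlt

/-- A convex neighbourhood with few terms lies inside the class of its point, so saturated sets are
open. -/
theorem LocallyFew.isOpen (h : LocallyFew μ y) {A : Set X}
    (hA : ∀ a ∈ A, ∀ b, FewBetween μ y a b → b ∈ A) : IsOpen A := by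
  rw [isOpen_iff_forall_mem_open]
  intro x hx
  obtain ⟨U, hU, hconv, hxU, hlt⟩ := h x
  exact ⟨U, fun b hb => hA x hx b
    ((mk_setOf_mem_mono y (hconv.uIcc_subset hxU hb)).trans_lt hlt), hU, hxU⟩

theorem LocallyFew.isOpen_compl (h : LocallyFew μ y) {A : Set X}
    (hA : ∀ a ∈ A, ∀ b, FewBetween μ y a b → b ∈ A) : IsOpen Aᶜ :=
  h.isOpen fun a ha b hab hb => ha (hA b hb a hab.symm)

/-- If the points above `x` that are separated from it by few members of `y` include many members
of `y`, then they determine a cut. -/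
theorem LocallyFew.hasLeftCutOfType_of_class (h : LocallyFew μ y) (hμ : μ.IsRegular) {x : X}
    (hx : #{j | FewBetween μ y x (y j) ∧ x ≤ y j} = μ) : HasLeftCutOfType X μ := by
  have hsat : ∀ a ∈ {a | ∃ t : {j | FewBetween μ y x (y j) ∧ x ≤ y j}, a ≤ y t}, ∀ b,
      FewBetween μ y a b →
      b ∈ {a | ∃ t : {j | FewBetween μ y x (y j) ∧ x ≤ y j}, a ≤ y t} := by
    rintro a ⟨⟨t, ht, hxt⟩, hat⟩ b hab
    -- Otherwise `b` lies above every term counted in `hx` while few terms separate it from `x`, but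
    -- all `μ` of those lie between `x` and `b`.
    by_contra hb
    simp only [mem_ofPred_eq, not_exists, not_le] at hb
    have htb : y t < b := hb ⟨t, ht, hxt⟩
    have hxb : FewBetween μ y x b := ht.trans hμ.aleph0_le
      (hab.mono (Icc_subset_uIcc ⟨hat, htb.le⟩) right_mem_uIcc)
    refine (lt_of_le_of_lt (mk_le_mk_of_subset fun j hj => ?_) hxb).not_ge hx.ge
    exact Icc_subset_uIcc ⟨hj.2, (hb ⟨j, hj⟩).le⟩
  refine hasLeftCutOfType_of_isClopen hμ hx (fun t => y t) (h.isOpen hsat) (h.isOpen_compl hsat) ?_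
  rintro ⟨t, ht, hxt⟩
  refine lt_of_le_of_lt (mk_le_of_injective (f := fun j => (⟨j.1.1, ?_⟩ : {j | y j ∈ uIcc x (y t)}))
    fun i j hij => Subtype.ext (Subtype.ext (Subtype.mk.inj hij))) ht
  exact Icc_subset_uIcc ⟨j.1.2.2, j.2⟩

/-- A strictly increasing sequence of points pairwise separated by many members of `y` determines
a cut. -/
theorem LocallyFew.hasLeftCutOfType_of_strictMono (h : LocallyFew μ y)
    {κ : Cardinal.{u}} (hκ : κ.IsRegular) {T : Set κ.ord.ToType} (hT : #T = κ) {e : T → X}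
    (he : StrictMono e) (hsep : ∀ s t, s ≠ t → ¬ FewBetween μ y (e s) (e t)) :
    HasLeftCutOfType X κ := by
  have hsat : ∀ a ∈ {a | ∃ t, a ≤ e t}, ∀ b, FewBetween μ y a b → b ∈ {a | ∃ t, a ≤ e t} := by
    rintro a ⟨t, hat⟩ b hab
    -- Otherwise `b` bounds the whole sequence, and two of its points are squeezed between `a` and
    -- `b`.
    by_contra hb
    simp only [mem_ofPred_eq, not_exists, not_le] at hb
    obtain ⟨s, hts⟩ : ∃ s : T, t < s := by
      by_contra! hle
      exact ((mk_le_mk_of_subset fun s hs => hle ⟨s, hs⟩).trans_lt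
        (mk_Iic_ordToType_lt hκ.aleph0_le t.1)).not_ge hT.ge
    exact hsep t s hts.ne (hab.mono (Icc_subset_uIcc ⟨hat, (hb t).le⟩)
      (Icc_subset_uIcc ⟨hat.trans (he hts).le, (hb s).le⟩))
  refine hasLeftCutOfType_of_isClopen hκ hT e (h.isOpen hsat) (h.isOpen_compl hsat) fun t => ?_
  refine lt_of_le_of_lt (mk_le_of_injective (f := fun j => (⟨j.1.1, ?_⟩ : Iic t.1))
    fun i j hij => Subtype.ext (Subtype.ext (Subtype.mk.inj hij)))
    (mk_Iic_ordToType_lt hκ.aleph0_le t.1)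
  exact he.le_iff_le.1 j.2

theorem exists_locallyFew_of_not_isIntervalCompact (hX : IsGOSpace X)
    (hμ : ℵ₀ ≤ μ) (hc : ¬ IsIntervalCompact μ μ X) : ∃ y : μ.ord.ToType → X, LocallyFew μ y := by
  simp only [IsIntervalCompact, not_forall] at hc
  obtain ⟨𝒰, hopen, hcov, hle, hno⟩ := hc
  have hno' : ∀ 𝒱 ⊆ 𝒰, #𝒱 < μ → ∃ x, x ∉ ⋃₀ 𝒱 := by
    intro 𝒱 h𝒱 hlt
    by_contra! hall
    exact hno ⟨𝒱, h𝒱, eq_univ_of_forall hall, hlt⟩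
  have hcard : #μ.ord.ToType = #𝒰 := by
    rw [mk_ord_toType]
    refine le_antisymm (not_lt.1 fun hlt => ?_) hle
    exact hno ⟨𝒰, subset_rfl, hcov, hlt⟩
  obtain ⟨g⟩ := Cardinal.eq.1 hcard
  -- Each `y i` avoids the members of the cover enumerated before `i`, so a given member contains
  -- only terms up to its own index.
  choose y hy using fun i : μ.ord.ToType => hno' ((fun j => (g j : Set X)) '' Iio i)
    (by rintro _ ⟨j, -, rfl⟩; exact (g j).2) (mk_image_le.trans_lt (mk_Iio_ordToType_lt i))
  refine ⟨y, fun x => ?_⟩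
  obtain ⟨U, hU, hxU⟩ := hcov.symm.subset (mem_univ x)
  obtain ⟨V, hV, hconv, hxV, hVU⟩ := hX.exists_ordConnected (hopen U hU) hxU
  refine ⟨V, hV, hconv, hxV, ?_⟩
  refine lt_of_le_of_lt (mk_le_mk_of_subset (t := Iic (g.symm ⟨U, hU⟩)) fun j hj => ?_) ?_
  · by_contra hlt
    exact hy j ⟨U, ⟨g.symm ⟨U, hU⟩, mem_Iio.2 (not_le.1 hlt), by simp⟩, hVU hj⟩
  · exact mk_Iic_ordToType_lt hμ _

end

end GOSpace

/-! ### Cuts obtained from weak compactness -/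

theorem IsWeaklyCompact.exists_strictMono_or_strictAnti {κ : Cardinal.{u}}
    (hκ : IsWeaklyCompact κ) {X : Type u} [LinearOrder X] {e : κ.ord.ToType → X}
    (he : Function.Injective e) : ∃ T : Set κ.ord.ToType, #T = κ ∧
      (StrictMono (fun t : T => e t) ∨ StrictAnti fun t : T => e t) := by
  have hsymm : ∀ i j, (i < j ↔ e i < e j) ↔ (j < i ↔ e j < e i) := by
    intro i j
    rcases eq_or_ne i j with rfl | hij
    · rfl
    · have h1 := lt_asymm (a := i) (b := j)
      have h2 := lt_asymm (a := e i) (b := e j)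
      have h3 := hij.lt_or_gt
      have h4 := (he.ne hij).lt_or_gt
      tauto
  classical
  obtain ⟨T, hT, i, hi⟩ := hκ.2 κ.ord.ToType (mk_ord_toType κ)
    (Sym2.lift ⟨fun i j => decide (i < j ↔ e i < e j), fun i j => by simp [hsymm i j]⟩)
  simp only [Sym2.lift_mk] at hi
  refine ⟨T, hT, ?_⟩
  cases i with
  | true =>
    refine .inl fun s t hst => ?_
    have hst' : s.1 < t.1 := hst
    exact (of_decide_eq_true (hi s s.2 t t.2 hst'.ne)).1 hst'
  | false =>
    refine .inr fun s t hst => ?_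
    have hst' : s.1 < t.1 := hst
    have := of_decide_eq_false (hi s s.2 t t.2 hst'.ne)
    exact lt_of_le_of_ne (not_lt.1 fun h => this ⟨fun _ => h, fun _ => hst'⟩)
      (he.ne hst'.ne')

section

variable {X : Type u} [LinearOrder X] [TopologicalSpace X] {κ μ : Cardinal.{u}} {J : Type u}
  {y : J → X}

theorem LocallyFew.hasLeftCutOfType_of_large_class (h : LocallyFew μ y) (hμ : μ.IsRegular)
    (hJ : #J = μ) {x : X} (hx : μ ≤ #{j | FewBetween μ y x (y j)}) :
    HasLeftCutOfType X μ ∨ HasLeftCutOfType Xᵒᵈ μ := by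
  by_contra! hno
  have hle : ∀ S : Set J, #S ≠ μ → #S < μ := fun S hS =>
    lt_of_le_of_ne ((mk_set_le S).trans_eq hJ) hS
  have h1 := hle {j | FewBetween μ y x (y j) ∧ x ≤ y j} fun hcard =>
    hno.1 (h.hasLeftCutOfType_of_class hμ hcard)
  have h2 := hle {j | FewBetween μ y x (y j) ∧ y j ≤ x} fun hcard =>
    hno.2 (h.dual.hasLeftCutOfType_of_class hμ (x := OrderDual.toDual x) ((congrArg
      (fun S : Set J => #S) (Set.ext fun j => and_congr fewBetween_dual_iff Iff.rfl)).trans hcard))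
  refine ((mk_le_mk_of_subset fun j hj => ?_).trans_lt (mk_union_lt hμ.aleph0_le h1 h2)).not_ge hx
  exact (le_total x (y j)).imp (fun h => ⟨hj, h⟩) fun h => ⟨hj, h⟩

/-- If the members of `y` fall into small classes, `κ` many of these are distinct. -/
theorem LocallyFew.exists_separated (h : LocallyFew μ y) (hμ : μ.IsRegular) (hκμ : κ ≤ μ)
    (hJ : #J = μ) (hsmall : ∀ x, #{j | FewBetween μ y x (y j)} < μ) :
    ∃ e : κ.ord.ToType → X, ∀ s t, s ≠ t → ¬ FewBetween μ y (e s) (e t) := by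
  let r : Setoid J :=
    { r := fun j k => FewBetween μ y (y j) (y k)
      iseqv := ⟨fun j => h.fewBetween_self (y j), FewBetween.symm,
        FewBetween.trans hμ.aleph0_le⟩ }
  have hQ : κ ≤ #(Quotient r) := by
    by_contra! hlt
    have hun : (⋃ q : Quotient r, {j | FewBetween μ y (y q.out) (y j)}) = Set.univ :=
      eq_univ_of_forall fun j => mem_iUnion.2 ⟨⟦j⟧, Quotient.mk_out (s := r) j⟩
    have := (card_iUnion_lt_iff_forall_of_isRegular
      (t := fun q : Quotient r => {j | FewBetween μ y (y q.out) (y j)}) hμ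
      (hlt.trans_le hκμ)).2 fun q => hsmall _
    rw [hun, mk_univ, hJ] at this
    exact this.false
  rw [← mk_ord_toType κ] at hQ
  obtain ⟨f⟩ := hQ
  exact ⟨fun i => y (f i).out, fun s t hst hfew => hst (f.injective (Quotient.out_equiv_out.1 hfew))⟩

theorem LocallyFew.hasLeftCutOfType_of_isWeaklyCompact (h : LocallyFew μ y)
    (hwc : IsWeaklyCompact κ) (hκ : κ.IsRegular) (hμ : μ.IsRegular) (hκμ : κ ≤ μ) (hJ : #J = μ) :
    (HasLeftCutOfType X μ ∨ HasLeftCutOfType Xᵒᵈ μ) ∨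
      (HasLeftCutOfType X κ ∨ HasLeftCutOfType Xᵒᵈ κ) := by
  by_cases! hbig : ∃ x, μ ≤ #{j | FewBetween μ y x (y j)}
  · obtain ⟨x, hx⟩ := hbig
    exact .inl (h.hasLeftCutOfType_of_large_class hμ hJ hx)
  · obtain ⟨e, he⟩ := h.exists_separated hμ hκμ hJ hbig
    have hinj : Function.Injective e := fun s t hst => by
      by_contra hne
      exact he s t hne (hst ▸ h.fewBetween_self (e s))
    have hsep : ∀ T : Set κ.ord.ToType, ∀ s t : T, s ≠ t → ¬ FewBetween μ y (e s) (e t) :=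
      fun T s t hst => he s t (Subtype.coe_injective.ne hst)
    obtain ⟨T, hT, hmono | hanti⟩ := hwc.exists_strictMono_or_strictAnti hinj
    · exact .inr (.inl (h.hasLeftCutOfType_of_strictMono hκ hT hmono (hsep T)))
    · refine .inr (.inr (h.dual.hasLeftCutOfType_of_strictMono hκ hT
        (e := fun t => OrderDual.toDual (e t)) (fun s t hst => hanti hst) fun s t hst => ?_))
      rw [fewBetween_dual_iff]
      exact hsep T s t hst

end

/-! ### The equivalence -/

theorem IsClassCompact.hasNoGapsIn {H : Set Cardinal.{u}} (hH : ∀ μ ∈ H, μ.IsRegular) {X : Type u}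
    [LinearOrder X] [TopologicalSpace X] (hX : IsGOSpace X) (hc : IsClassCompact H X) :
    HasNoGapsIn H X :=
  (hasNoGapsIn_iff hH).2 fun μ hμ =>
    ⟨(hc μ hμ).not_hasLeftCutOfType hX (hH μ hμ).aleph0_le,
      IsIntervalCompact.not_hasLeftCutOfType hX.dual (hH μ hμ).aleph0_le (hc μ hμ)⟩

theorem GP.of_isWeaklyCompact {H : Set Cardinal.{u}} (hH : ∀ μ ∈ H, μ.IsRegular)
    {κ : Cardinal.{u}} (hκH : κ ∈ H) (hmin : ∀ μ ∈ H, κ ≤ μ) (hwc : IsWeaklyCompact κ) : GP H := by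
  intro X _ _ hX
  refine ⟨fun hc => hc.hasNoGapsIn hH hX, fun hno μ hμ => ?_⟩
  rw [hasNoGapsIn_iff hH] at hno
  by_contra hc
  obtain ⟨y, hy⟩ := exists_locallyFew_of_not_isIntervalCompact hX (hH μ hμ).aleph0_le hc
  have := hy.hasLeftCutOfType_of_isWeaklyCompact hwc (hH κ hκH) (hH μ hμ) (hmin μ hμ)
    (mk_ord_toType μ)
  have h1 := hno μ hμ
  have h2 := hno κ hκH
  tauto

theorem GP.lotsGP {H : Set Cardinal.{u}} (h : GP H) : LOTSGP H :=
  fun X _ _ _ => h X IsGOSpace.of_orderTopology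

theorem not_isIntervalCompact_of_discreteTopology {X : Type u} [TopologicalSpace X]
    [DiscreteTopology X] : ¬ IsIntervalCompact #X #X X := by
  intro hc
  obtain ⟨𝒱, h𝒱, hcov, hlt⟩ := hc (range fun x : X => {x}) (fun U _ => isOpen_discrete U)
    (eq_univ_of_forall fun x => ⟨{x}, ⟨x, rfl⟩, rfl⟩) mk_range_le
  refine hlt.not_ge (mk_le_of_injective (f := fun x : X => (⟨{x}, ?_⟩ : 𝒱)) fun x z hxz =>
    singleton_injective (Subtype.mk.inj hxz))
  obtain ⟨U, hU, hxU⟩ := hcov.symm.subset (mem_univ x)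
  obtain ⟨z, rfl⟩ := h𝒱 hU
  rwa [mem_singleton_iff.1 hxU]

theorem LOTSGP.isWeaklyCompact {H : Set Cardinal.{u}} (hH : ∀ μ ∈ H, μ.IsRegular)
    {κ : Cardinal.{u}} (hκH : κ ∈ H) (hmin : ∀ μ ∈ H, κ ≤ μ) (hω : ℵ₀ < κ) (h : LOTSGP H) :
    IsWeaklyCompact κ := by
  by_contra hwc
  obtain ⟨X, _, hX, hdisc, hseq⟩ := exists_linearOrder_of_not_isWeaklyCompact (hH κ hκH) hω hwc
  let _ : TopologicalSpace X := Preorder.topology X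
  have : OrderTopology X := ⟨rfl⟩
  have : DiscreteTopology X := discreteTopology_iff_isOpen_singleton.2 fun x => by
    obtain ⟨a, b, hab⟩ := hdisc x
    exact hab ▸ isOpen_Ioo
  refine not_isIntervalCompact_of_discreteTopology (X := X)
    (hX.symm ▸ (h X).2 ((hasNoGapsIn_iff hH).2 fun μ hμ => ?_) κ hκH)
  -- A type in `H` is at least `κ`, while `#Y = κ` bounds it above; so only type `κ` can occur.
  have hcof : ∀ {Y : Type u} [LinearOrder Y] (A : Set Y), #Y = κ → setCof A = μ →
      Order.cof A = κ := fun A hY hA => le_antisymm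
    ((Order.cof_le_cardinalMk _).trans ((mk_set_le A).trans_eq hY)) ((hmin μ hμ).trans_eq hA.symm)
  constructor
  · rintro ⟨A, -, -, -, hA⟩
    obtain ⟨f, hf⟩ := exists_strictMono_of_cof_eq (hcof A hX hA)
    exact (hseq fun i => f i).1 fun i j hij => hf hij
  · rintro ⟨A, -, -, -, hA⟩
    obtain ⟨f, hf⟩ := exists_strictMono_of_cof_eq (hcof A hX hA)
    exact (hseq fun i => OrderDual.ofDual (f i).1).2 fun i j hij => hf hij

theorem theorem5p4 (H : Set Cardinal.{u}) (hH : ∀ μ ∈ H, μ.IsRegular)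
    (κ : Cardinal.{u}) (hκ : κ = sInf H) (hω : ℵ₀ < κ) :
    (IsWeaklyCompact κ ↔ GP H) ∧ (IsWeaklyCompact κ ↔ LOTSGP H) := by
  have hne : H.Nonempty := by
    -- The convention `sInf ∅ = 0` contradicts `ℵ₀ < κ`.
    by_contra hemp
    rw [not_nonempty_iff_eq_empty.1 hemp, sInf_empty] at hκ
    exact not_lt_zero (hκ ▸ hω)
  have hκH : κ ∈ H := hκ ▸ csInf_mem hne
  have hmin : ∀ μ ∈ H, κ ≤ μ := fun μ hμ => hκ ▸ csInf_le' hμ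
  have hGP : IsWeaklyCompact κ → GP H := GP.of_isWeaklyCompact hH hκH hmin
  have hwc : LOTSGP H → IsWeaklyCompact κ := LOTSGP.isWeaklyCompact hH hκH hmin hω
  exact ⟨⟨hGP, fun h => hwc h.lotsGP⟩, fun h => (hGP h).lotsGP, hwc⟩
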